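/- Let $X$ be a compact metrizable space and $T:X\to X$ a homeomorphism. Recall that the order of a finite open cover $\alpha$ of $X$ is $\operatorname{ord}(\alpha)=\sup_{x\in X}\bigl(\#\{U\in\alpha : x\in U\}-1\bigr)$, that $D(\alpha)$ is the minimum of $\operatorname{ord}(\beta)$ over all finite open covers $\beta$ of $X$ refining $\alpha$ (every member of $\beta$ is contained in a member of $\alpha$), and that the topological dimension of $X$ is $\dim X=\sup_\alpha D(\alpha)\in\mathbb N\cup\{\infty\}$, where $\alpha$ ranges over all finite open covers of $X$. Assume that $\dim X<\infty$ and that $(X,T)$ is aperiodic, i.e. there are no $x\in X$ and $p\ge 1$ with $T^p(x)=x$. Then $(X,T)$ has the marker property: for every $n\in\mathbb N$ there is an open set $F\subset X$ such that 1. $F\cap T^i(F)=\emptyset$ for all $i\in\{1,\dots,n-1\}$, and 2. there is $m\in\mathbb N$ with $X=\bigcup_{i=1}^{m}T^i(F)$. -/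

import Mathlib

namespace MarkerProperty

/-- `α` is a finite open cover of `X`, given as a finite set of open sets. -/
structure IsFiniteOpenCover {X : Type*} [TopologicalSpace X] (α : Set (Set X)) : Prop where
  finite : α.Finite
  isOpen : ∀ U ∈ α, IsOpen U
  sUnion_eq : ⋃₀ α = Set.univ

/-- `β` is a refinement of `α`: every member of `β` is contained in a member of `α`. -/
def Refines {X : Type*} (β α : Set (Set X)) : Prop :=
  ∀ V ∈ β, ∃ U ∈ α, V ⊆ U

/-- The order of a cover `α`: the supremum over `x` of the number of members of `α` containing `x`,
minus one. (For a cover every point lies in at least one member, so nothing is truncated.) -/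
noncomputable def coverOrder {X : Type*} (α : Set (Set X)) : ℕ∞ :=
  ⨆ x : X, ({U | U ∈ α ∧ x ∈ U}.encard - 1)

/-- `D(α)`: the minimum of the orders of the finite open covers refining `α`. -/
noncomputable def refinementOrder {X : Type*} [TopologicalSpace X] (α : Set (Set X)) : ℕ∞ :=
  ⨅ (β : Set (Set X)) (_ : IsFiniteOpenCover β ∧ Refines β α), coverOrder β

/-- The topological (covering) dimension of `X`: the supremum of `D(α)` over all finite open
covers `α` of `X`, possibly `⊤`. -/
noncomputable def topologicalDim (X : Type*) [TopologicalSpace X] : ℕ∞ :=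
  ⨆ (α : Set (Set X)) (_ : IsFiniteOpenCover α), refinementOrder α

/-- The system `(X, T)` is aperiodic: it has no periodic point. -/
def IsAperiodic {X : Type*} [TopologicalSpace X] (T : X ≃ₜ X) : Prop :=
  Function.periodicPts T = ∅

/-- `F` is an `n`-marker of `(X, T)`: `F ∩ T^i F = ∅` for `1 ≤ i ≤ n - 1`, and finitely many of the
translates `T F, T^2 F, …` cover `X`. -/
def IsMarker {X : Type*} [TopologicalSpace X] (T : X ≃ₜ X) (n : ℕ) (F : Set X) : Prop :=
  (∀ i : ℕ, 1 ≤ i → i < n → F ∩ (T^[i] '' F) = ∅) ∧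
    ∃ m : ℕ, Set.univ = ⋃ i ∈ Finset.Icc 1 m, (T^[i] '' F)

/-- The marker property: for every `n` there is an open `n`-marker. -/
def HasMarkerProperty {X : Type*} [TopologicalSpace X] (T : X ≃ₜ X) : Prop :=
  ∀ n : ℕ, ∃ F : Set X, IsOpen F ∧ IsMarker T n F

end MarkerProperty

open Topology

namespace MarkerProperty

/-! Cover `X` by finitely many sets on which bump functions `f i` equal 1, each vanishing off a set
`V i` disjoint from its translates by nonzero times in `[-n, n]`. A greedy choice through the sets
`{f i > 1/2}` would give a marker, but openness fails where some `f i` equals 1/2 along the orbit.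

Finite dimension controls these failures. With `d = dim X`, a small perturbation `g` of `f` has, for
every `x`, at most `d` pairs `(i, a)` in a prescribed window of times with `g i (T^a x) = 1/2`
(`dense_genericOn_univ`, by general position in the nerve of a cover). The greedy choice depends
only on times up to `m`, the number of functions times `n`. Among `d + 1` disjoint blocks of length
`2m + 1` along an orbit, one avoids every failure; at its centre the greedy choice is decided and
meets `F` within `n` steps (`exists_greedy_marker`, `exists_clean_translate`). Return times to the
open set `F` are thus bounded. -/

theorem exists_refinement_encard_le {X : Type*} [TopologicalSpace X]
    (hdim : topologicalDim X < ⊤) :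
    ∃ d : ℕ, ∀ α : Set (Set X), IsFiniteOpenCover α →
      ∃ β : Set (Set X), IsFiniteOpenCover β ∧ Refines β α ∧
        ∀ x, {U | U ∈ β ∧ x ∈ U}.encard ≤ d + 1 := by
  obtain ⟨d, hd⟩ := ENat.ne_top_iff_exists.mp hdim.ne
  refine ⟨d, fun α hα => ?_⟩
  have h1 : refinementOrder α ≤ d := by
    rw [hd]
    exact le_iSup₂ (f := fun (α : Set (Set X)) (_ : IsFiniteOpenCover α) => refinementOrder α) α hα
  have h2 : refinementOrder α < (d + 1 : ℕ) :=
    lt_of_le_of_lt h1 (by exact_mod_cast Nat.lt_succ_self d)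
  simp only [refinementOrder, iInf_lt_iff] at h2
  obtain ⟨β, ⟨hβ, hr⟩, h3⟩ := h2
  refine ⟨β, hβ, hr, fun x => ?_⟩
  have h4 : {U | U ∈ β ∧ x ∈ U}.encard - 1 ≤ coverOrder β :=
    le_iSup (fun x : X => {U | U ∈ β ∧ x ∈ U}.encard - 1) x
  have h5 : {U | U ∈ β ∧ x ∈ U}.encard - 1 ≤ d := by
    have := h4.trans_lt h3
    push_cast at this
    exact Order.le_of_lt_add_one this
  exact tsub_le_iff_right.mp h5

/-! ### General position and maps through the nerve of a cover -/

open MvPolynomial in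
/-- Every family of vectors can be perturbed so that it is in general position with respect to
all coordinate projections. -/
theorem exists_general_position {β κ : Type*} [Fintype β] [Fintype κ] (P : β → κ → ℝ) {ε : ℝ}
    (hε : 0 < ε) :
    ∃ Q : β → κ → ℝ, (∀ v a, |Q v a - P v a| < ε) ∧
      ∀ (c : β → ℝ) (A : Finset κ), (Function.support c).ncard ≤ A.card →
        (∀ a ∈ A, ∑ v, c v * Q v a = 0) → c = 0 := by
  classical
  let D : (r : ℕ) → (Fin r ↪ β) → (Fin r ↪ κ) → MvPolynomial (β × κ) ℝ := fun r e f =>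
    (Matrix.of fun i j => X (e i, f j)).det
  have evalD : ∀ r e f (q : β × κ → ℝ),
      eval q (D r e f) = (Matrix.of fun i j => q (e i, f j)).det := by
    intro r e f q
    simp only [D]
    rw [RingHom.map_det]
    congr 1
    ext i j
    simp
  have hD : ∀ r e f, D r e f ≠ 0 := by
    intro r e f h
    -- The minor is a nonzero polynomial: at this 0-1 matrix, matching `e i` with `f i`, it is the
    -- identity determinant.
    have h1 := evalD r e f fun p => if ∃ i, e i = p.1 ∧ f i = p.2 then 1 else 0
    have h2 : (Matrix.of fun i j => (if ∃ l, e l = e i ∧ f l = f j then 1 else 0 : ℝ)) =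
        (1 : Matrix (Fin r) (Fin r) ℝ) := by
      ext i j
      simp [Matrix.one_apply]
    rw [h2, h] at h1
    simp at h1
  let p : MvPolynomial (β × κ) ℝ :=
    ∏ r ∈ Finset.range (Fintype.card β + 1), ∏ e : Fin r ↪ β, ∏ f : Fin r ↪ κ, D r e f
  have hp : p ≠ 0 := by
    simp only [p, Finset.prod_ne_zero_iff]
    intros
    exact hD _ _ _
  obtain ⟨q, hq, hpq⟩ : ∃ q ∈ Set.pi Set.univ
      (fun z : β × κ => Set.Ioo (P z.1 z.2 - ε) (P z.1 z.2 + ε)), eval q p ≠ 0 := by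
    by_contra! h
    refine hp (MvPolynomial.funext_set
      (fun z : β × κ => Set.Ioo (P z.1 z.2 - ε) (P z.1 z.2 + ε))
      (fun z => Set.Ioo_infinite (by linarith)) fun q hq => ?_)
    rw [h q hq, map_zero]
  refine ⟨fun v a => q (v, a), fun v a => ?_, fun c A hA hc => ?_⟩
  · have := hq (v, a) trivial
    rw [abs_lt]
    constructor <;> linarith [this.1, this.2]
  · set S : Finset β := Finset.univ.filter fun v => c v ≠ 0 with hS
    have hSA : S.card ≤ A.card := by
      convert hA
      rw [← Set.ncard_coe_finset]
      congr 1
      ext v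
      simp [hS]
    obtain ⟨A', hA', hcard⟩ := Finset.exists_subset_card_eq hSA
    let e : Fin S.card ↪ β := S.equivFin.symm.toEmbedding.trans (Function.Embedding.subtype _)
    let f : Fin S.card ↪ κ :=
      (A'.equivFinOfCardEq hcard).symm.toEmbedding.trans (Function.Embedding.subtype _)
    have hdet : (Matrix.of fun i j => q (e i, f j)).det ≠ 0 := by
      rw [← evalD]
      simp only [p, map_prod, Finset.prod_ne_zero_iff] at hpq
      exact hpq _ (Finset.mem_range.mpr (Nat.lt_succ_of_le (Finset.card_le_univ S))) _
        (Finset.mem_univ _) _ (Finset.mem_univ _)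
    have h0 := Matrix.eq_zero_of_vecMul_eq_zero hdet (v := fun i => c (e i)) (by
      ext j
      have hj : f j ∈ A := hA' (Subtype.property _)
      have := hc _ hj
      rw [Pi.zero_apply, ← this]
      simp only [Matrix.vecMul, dotProduct, Matrix.of_apply]
      rw [← Finset.sum_subset (Finset.subset_univ S) (by intro v _ hv; simp [hS] at hv; simp [hv])]
      rw [← Finset.sum_coe_sort S]
      exact Fintype.sum_equiv S.equivFin.symm _ _ fun i => rfl)
    by_contra hne
    obtain ⟨v, hv⟩ := Function.ne_iff.mp hne
    have hvS : v ∈ S := by simpa [hS] using hv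
    have := congrFun h0 (S.equivFin ⟨v, hvS⟩)
    simp [e] at this
    exact hv this

/-- In a compact Hausdorff space whose covers have refinements of order at most `d`, every map to
`κ → ℝ` is uniformly close to one with at most `d` coordinates equal to `t` at each point. -/
theorem exists_approx_ncard_eq_le {X : Type*} [TopologicalSpace X] [CompactSpace X] [T2Space X]
    {d : ℕ} (hd : ∀ α : Set (Set X), IsFiniteOpenCover α →
      ∃ β : Set (Set X), IsFiniteOpenCover β ∧ Refines β α ∧
        ∀ x, {U | U ∈ β ∧ x ∈ U}.encard ≤ d + 1)
    {κ : Type*} [Fintype κ] (G : C(X, κ → ℝ)) (t : ℝ) {ε : ℝ} (hε : 0 < ε) :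
    ∃ H : C(X, κ → ℝ), (∀ x a, |H x a - G x a| < ε) ∧
      ∀ x (A : Finset κ), (∀ a ∈ A, H x a = t) → A.card ≤ d := by
  classical
  let W : X → Set X := fun p => G ⁻¹' Metric.ball (G p) (ε / 2)
  have hWo : ∀ p, IsOpen (W p) := fun p => Metric.isOpen_ball.preimage G.continuous
  obtain ⟨s, hs⟩ := isCompact_univ.elim_finite_subcover W hWo
    (fun x _ => Set.mem_iUnion.mpr ⟨x, Metric.mem_ball_self (by positivity)⟩)
  obtain ⟨β, hβ, hr, hord⟩ := hd (W '' s)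
    ⟨s.finite_toSet.image W, by rintro _ ⟨p, -, rfl⟩; exact hWo p,
      Set.eq_univ_of_univ_subset (by simpa [Set.sUnion_image] using hs)⟩
  have : Finite β := hβ.finite
  have := Fintype.ofFinite β
  have hcen : ∀ V : β, ∃ p : κ → ℝ, ∀ y ∈ V.1, ∀ a, |p a - G y a| < ε / 2 := by
    intro V
    obtain ⟨_, ⟨p, -, rfl⟩, hV⟩ := hr V.1 V.2
    refine ⟨G p, fun y hy a => ?_⟩
    have h1 : dist (G y) (G p) < ε / 2 := hV hy
    have h2 := (dist_le_pi_dist (G y) (G p) a).trans_lt h1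
    rwa [dist_comm, Real.dist_eq] at h2
  choose p hp using hcen
  -- Subtracting `t` makes "coordinate equal to `t`" a homogeneous linear condition on the weights
  -- `φ V x`, since these sum to 1.
  obtain ⟨Q, hQ, hgen⟩ := exists_general_position (fun V a => p V a - t) (half_pos hε)
  obtain ⟨φ, hφ⟩ := PartitionOfUnity.exists_isSubordinate_of_locallyFinite (X := X) isClosed_univ
    (fun V : β => V.1) (fun V => hβ.isOpen _ V.2) (locallyFinite_of_finite _)
    (by rw [← Set.sUnion_eq_iUnion, hβ.sUnion_eq])
  have hsum : ∀ x, ∑ V, φ V x = 1 := fun x => by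
    rw [← finsum_eq_sum_of_fintype]
    exact φ.sum_eq_one (Set.mem_univ x)
  have hmem : ∀ V x, φ V x ≠ 0 → x ∈ V.1 := fun V x h => hφ V (subset_tsupport _ h)
  have hH : ∀ x a, ∑ V, φ V x * (Q V a + t) = (∑ V, φ V x * Q V a) + t := fun x a => by
    simp only [mul_add, Finset.sum_add_distrib, ← Finset.sum_mul, hsum, one_mul]
  refine ⟨⟨fun x a => ∑ V, φ V x * (Q V a + t), by fun_prop⟩, fun x a => ?_, fun x A hA => ?_⟩
  · have h1 : ∑ V, φ V x * (Q V a + t) - G x a = ∑ V, φ V x * (Q V a + t - G x a) := by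
      simp only [mul_sub, Finset.sum_sub_distrib, ← Finset.sum_mul, hsum, one_mul]
    have h2 : ∀ V, φ V x ≠ 0 → |Q V a + t - G x a| < ε := fun V hV => by
      have h3 := hQ V a
      have h4 := hp V x (hmem V x hV) a
      rw [abs_lt] at *
      constructor <;> linarith [h3.1, h3.2, h4.1, h4.2]
    obtain ⟨V₀, hV₀⟩ : ∃ V, φ V x ≠ 0 := by
      by_contra! h
      simpa [h] using hsum x
    simp only [ContinuousMap.coe_mk]
    rw [h1]
    calc |∑ V, φ V x * (Q V a + t - G x a)| ≤ ∑ V, |φ V x * (Q V a + t - G x a)| :=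
          Finset.abs_sum_le_sum_abs _ _
      _ < ∑ V, φ V x * ε := by
          refine Finset.sum_lt_sum (fun V _ => ?_) ⟨V₀, Finset.mem_univ _, ?_⟩
          · rw [abs_mul, abs_of_nonneg (φ.nonneg V x)]
            by_cases hV : φ V x = 0
            · simp [hV]
            · exact mul_le_mul_of_nonneg_left (h2 V hV).le (φ.nonneg V x)
          · rw [abs_mul, abs_of_nonneg (φ.nonneg V₀ x)]
            exact mul_lt_mul_of_pos_left (h2 V₀ hV₀) ((φ.nonneg V₀ x).lt_of_ne' hV₀)
      _ = ε := by rw [← Finset.sum_mul, hsum, one_mul]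
  · by_contra! hcard
    -- At most `d + 1` weights are nonzero at `x`, so `d + 1` vanishing coordinates would force all
    -- weights to be 0.
    have h0 := hgen (fun V => φ V x) A ?_ ?_
    · have := hsum x
      simp [congrFun h0] at this
    · have h1 : (Subtype.val '' Function.support fun V : β => φ V x) ⊆ {U | U ∈ β ∧ x ∈ U} := by
        rintro _ ⟨V, hV, rfl⟩
        exact ⟨V.2, hmem V x hV⟩
      have h2 := (Set.encard_le_encard h1).trans (hord x)
      rw [Subtype.val_injective.injOn.encard_image, ← Set.Finite.cast_ncard_eq (Set.toFinite _)] at h2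
      have h3 : (Function.support fun V : β => φ V x).ncard ≤ d + 1 := by exact_mod_cast h2
      omega
    · intro a ha
      have h1 : ∑ V, φ V x * (Q V a + t) = t := hA a ha
      rw [hH] at h1
      linarith

/-! ### Generic functions along aperiodic orbits -/

theorem IsAperiodic.zpow_apply_ne {X : Type*} [TopologicalSpace X] {T : X ≃ₜ X}
    (hT : IsAperiodic T) {a : ℤ} (ha : a ≠ 0) (x : X) : (T ^ a) x ≠ x := by
  intro h
  have hpow : ∀ n : ℕ, ⇑(T ^ n) = T^[n] := fun n => hom_coe_pow _ rfl (fun _ _ => rfl) _ _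
  have h1 : (T ^ a.natAbs) x = x := by
    rw [← zpow_natCast]
    rcases Int.natAbs_eq a with h' | h'
    · rwa [← h']
    · have e : (a.natAbs : ℤ) = -a := by omega
      rw [e, zpow_neg, Homeomorph.inv_apply, Homeomorph.symm_apply_eq]
      exact h.symm
  have h2 : x ∈ Function.periodicPts T :=
    ⟨a.natAbs, Int.natAbs_pos.mpr ha, by rw [Function.IsPeriodicPt, ← hpow]; exact h1⟩
  rw [hT] at h2
  exact h2

theorem IsAperiodic.exists_isOpen_zpow_apply_notMem {X : Type*} [TopologicalSpace X] [T2Space X]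
    {T : X ≃ₜ X} (hT : IsAperiodic T) (J : Finset ℤ) (x : X) :
    ∃ V : Set X, IsOpen V ∧ x ∈ V ∧ ∀ a ∈ J, a ≠ 0 → ∀ y ∈ V, (T ^ a) y ∉ V := by
  classical
  induction J using Finset.induction_on with
  | empty => exact ⟨Set.univ, isOpen_univ, trivial, by simp⟩
  | insert a J _ ih =>
    obtain ⟨V, hVo, hxV, hV⟩ := ih
    by_cases ha : a = 0
    · refine ⟨V, hVo, hxV, fun b hb hb0 => hV b ?_ hb0⟩
      exact (Finset.mem_insert.mp hb).resolve_left (fun h => hb0 (h.trans ha))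
    · obtain ⟨U, W, hU, hW, hxU, hxW, hUW⟩ := t2_separation (hT.zpow_apply_ne ha x)
      refine ⟨V ∩ W ∩ (T ^ a) ⁻¹' U, (hVo.inter hW).inter (hU.preimage (T ^ a).continuous),
        ⟨⟨hxV, hxW⟩, hxU⟩, fun b hb hb0 y hy hby => ?_⟩
      rcases Finset.mem_insert.mp hb with rfl | hb
      · exact Set.disjoint_left.mp hUW hy.2 hby.1.2
      · exact hV b hb hb0 y hy.1.1 hby.1.1

/-- For generic `g`, every point of `K` has at most `d` translates within the window `J` at which
some coordinate of `g` takes the value `t`, counted with multiplicity. -/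
def genericOn {X : Type*} [TopologicalSpace X] (T : X ≃ₜ X) (ι : Type*) (d : ℕ) (J : Finset ℤ)
    (t : ℝ) (K : Set X) : Set C(X, ι → ℝ) :=
  {g | ∀ x ∈ K, ∀ A : Finset (ι × J), (∀ p ∈ A, g ((T ^ p.2.1) x) p.1 = t) → A.card ≤ d}

theorem isOpen_genericOn {X : Type*} [TopologicalSpace X] [CompactSpace X] [T2Space X]
    (T : X ≃ₜ X) (ι : Type*) [Fintype ι] (d : ℕ) (J : Finset ℤ) (t : ℝ) {K : Set X}
    (hK : IsClosed K) : IsOpen (genericOn T ι d J t K) := by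
  have hopen : IsOpen {z : C(X, ι → ℝ) × X |
      ∀ A : Finset (ι × J), (∀ p ∈ A, z.1 ((T ^ p.2.1) z.2) p.1 = t) → A.card ≤ d} := by
    have hset : {z : C(X, ι → ℝ) × X |
        ∀ A : Finset (ι × J), (∀ p ∈ A, z.1 ((T ^ p.2.1) z.2) p.1 = t) → A.card ≤ d} =
        ⋂ A : {A : Finset (ι × J) // d < A.card}, ⋃ p ∈ A.1,
          {z : C(X, ι → ℝ) × X | z.1 ((T ^ p.2.1) z.2) p.1 ≠ t} := by
      ext z
      simp only [Set.mem_iInter, Set.mem_iUnion, Subtype.forall, exists_prop]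
      refine forall_congr' fun A => ?_
      rw [← not_imp_not, not_le]
      simp
    rw [hset]
    refine isOpen_iInter_of_finite fun A => isOpen_iUnion fun p => isOpen_iUnion fun _ =>
      isOpen_ne_fun ?_ continuous_const
    have h : Continuous fun z : C(X, ι → ℝ) × X => z.1 ((T ^ p.2.1) z.2) :=
      ContinuousEval.continuous_eval.comp
        (continuous_fst.prodMk ((T ^ p.2.1).continuous.comp continuous_snd))
    exact (continuous_apply p.1).comp h
  rw [isOpen_iff_eventually]
  intro g hg
  exact hK.isCompact.eventually_forall_of_forall_eventually fun x hx =>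
    hopen.mem_nhds (hg x hx)

/-- Since the sets `T^a V`, `a ∈ J`, are pairwise disjoint, the values of `g` at the times in `J`
along the orbit of a point of `K` can be perturbed independently, as if they were coordinates of one
map on `X`. -/
theorem dense_genericOn_of_subset {X : Type*} [TopologicalSpace X] [CompactSpace X] [T2Space X]
    {d : ℕ} (hd : ∀ α : Set (Set X), IsFiniteOpenCover α →
      ∃ β : Set (Set X), IsFiniteOpenCover β ∧ Refines β α ∧
        ∀ x, {U | U ∈ β ∧ x ∈ U}.encard ≤ d + 1)
    (T : X ≃ₜ X) (ι : Type*) [Fintype ι] (J : Finset ℤ) (t : ℝ) {K V : Set X}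
    (hK : IsClosed K) (hV : IsOpen V) (hKV : K ⊆ V)
    (hJV : ∀ a ∈ J, ∀ b ∈ J, a ≠ b → ∀ y ∈ V, (T ^ (b - a)) y ∉ V) :
    Dense (genericOn T ι d J t K) := by
  classical
  rw [Metric.dense_iff]
  intro g r hr
  obtain ⟨ψ, hψ0, hψ1, hψ⟩ := exists_continuous_zero_one_of_isClosed hV.isClosed_compl hK
    (Set.disjoint_left.mpr fun x hx hxK => hx (hKV hxK))
  let G : C(X, ι × J → ℝ) := ⟨fun x p => g ((T ^ p.2.1) x) p.1, by
    refine continuous_pi fun p => ?_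
    exact (continuous_apply p.1).comp (g.continuous.comp (T ^ p.2.1).continuous)⟩
  obtain ⟨H, hHG, hH⟩ := exists_approx_ncard_eq_le hd G t
    (show 0 < r / (Fintype.card J + 1) by positivity)
  -- The correction `H - G` of coordinate `(i, a)` is cut off by `ψ` and carried to `T^a V`.
  let g' : C(X, ι → ℝ) := ⟨fun y i => g y i + ∑ a : J, ψ ((T ^ (-a.1)) y) *
      (H ((T ^ (-a.1)) y) (i, a) - G ((T ^ (-a.1)) y) (i, a)), by
    have h : ∀ a : ℤ, Continuous (T ^ a) := fun a => (T ^ a).continuous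
    have h1 : ∀ a : ℤ, Continuous fun y => ψ ((T ^ a) y) := fun a => ψ.continuous.comp (h a)
    have h2 : ∀ a : ℤ, Continuous fun y => H ((T ^ a) y) := fun a => H.continuous.comp (h a)
    have h3 : ∀ a : ℤ, Continuous fun y => G ((T ^ a) y) := fun a => G.continuous.comp (h a)
    refine continuous_pi fun i => ((continuous_apply i).comp g.continuous).add
      (continuous_finsetSum _ fun a _ => (h1 _).mul (Continuous.sub ?_ ?_))
    · exact (continuous_apply (i, a)).comp (h2 _)
    · exact (continuous_apply (i, a)).comp (h3 _)⟩
  refine ⟨g', ?_, ?_⟩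
  · rw [Metric.mem_ball, ContinuousMap.dist_lt_iff hr]
    refine fun y => (dist_pi_lt_iff hr).mpr fun i => ?_
    rw [Real.dist_eq]
    simp only [g', ContinuousMap.coe_mk, add_sub_cancel_left]
    calc _ ≤ ∑ a : J, |ψ ((T ^ (-a.1)) y) *
          (H ((T ^ (-a.1)) y) (i, a) - G ((T ^ (-a.1)) y) (i, a))| :=
          Finset.abs_sum_le_sum_abs _ _
      _ ≤ ∑ a : J, r / (Fintype.card J + 1) := by
          refine Finset.sum_le_sum fun a _ => ?_
          rw [abs_mul, abs_of_nonneg (hψ _).1]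
          have h1 := (hHG ((T ^ (-a.1)) y) (i, a)).le
          have h2 := hψ ((T ^ (-a.1)) y)
          calc _ ≤ 1 * (r / (Fintype.card J + 1)) :=
                mul_le_mul h2.2 h1 (abs_nonneg _) zero_le_one
            _ = _ := one_mul _
      _ < r := by
          rw [Finset.sum_const, nsmul_eq_mul, Finset.card_univ, ← mul_div_assoc,
            div_lt_iff₀ (by positivity)]
          nlinarith
  · intro x hx A hA
    refine hH x A fun p hp => ?_
    rw [← hA p hp]
    simp only [g', ContinuousMap.coe_mk]
    have hcomp : ∀ a : ℤ, (T ^ (-a)) ((T ^ p.2.1) x) = (T ^ (p.2.1 - a)) x := fun a => by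
      rw [← Homeomorph.mul_apply, ← zpow_add, neg_add_eq_sub]
    simp only [hcomp]
    rw [Finset.sum_eq_single p.2]
    · have h1 : ψ x = 1 := hψ1 hx
      simp [h1, G]
    · intro a _ hap
      have h1 : ψ ((T ^ (p.2.1 - a.1)) x) = 0 :=
        hψ0 (hJV a.1 a.2 p.2.1 p.2.2 (fun h => hap (Subtype.ext h)) x (hKV hx))
      rw [h1, zero_mul]
    · simp

theorem dense_genericOn_univ {X : Type*} [TopologicalSpace X] [CompactSpace X] [T2Space X]
    {d : ℕ} (hd : ∀ α : Set (Set X), IsFiniteOpenCover α →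
      ∃ β : Set (Set X), IsFiniteOpenCover β ∧ Refines β α ∧
        ∀ x, {U | U ∈ β ∧ x ∈ U}.encard ≤ d + 1)
    {T : X ≃ₜ X} (hT : IsAperiodic T) (ι : Type*) [Fintype ι] (J : Finset ℤ) (t : ℝ) :
    Dense (genericOn T ι d J t Set.univ) := by
  classical
  have hloc : ∀ x : X, ∃ K V : Set X, K ∈ 𝓝 x ∧ IsClosed K ∧ IsOpen V ∧ K ⊆ V ∧
      ∀ a ∈ J, ∀ b ∈ J, a ≠ b → ∀ y ∈ V, (T ^ (b - a)) y ∉ V := by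
    intro x
    obtain ⟨V, hVo, hxV, hV⟩ := hT.exists_isOpen_zpow_apply_notMem
      ((J ×ˢ J).image fun p => p.2 - p.1) x
    obtain ⟨K, hKx, hK, hKV⟩ := exists_mem_nhds_isClosed_subset (hVo.mem_nhds hxV)
    refine ⟨K, V, hKx, hK, hVo, hKV, fun a ha b hb hab => hV _ ?_ (sub_ne_zero.mpr hab.symm)⟩
    exact Finset.mem_image.mpr ⟨(a, b), Finset.mem_product.mpr ⟨ha, hb⟩, rfl⟩
  choose K V hKx hK hVo hKV hV using hloc
  obtain ⟨s, -, hs⟩ := isCompact_univ.elim_nhds_subcover K fun x _ => hKx x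
  have hdense : Dense (⋂ x : s, genericOn T ι d J t (K x)) :=
    dense_iInter_of_isOpen (fun x => isOpen_genericOn T ι d J t (hK x))
      fun x => dense_genericOn_of_subset hd T ι J t (hK x) (hVo x) (hKV x) (hV x)
  refine hdense.mono fun g hg x _ => ?_
  obtain ⟨y, hy, hxy⟩ := Set.mem_iUnion₂.mp (hs (Set.mem_univ x))
  exact Set.mem_iInter.mp hg ⟨y, hy⟩ x hxy

/-! ### Greedy markers and bounded return times -/

theorem zpow_apply_zpow_apply {X : Type*} [TopologicalSpace X] (T : X ≃ₜ X) (a b : ℤ) (x : X) :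
    (T ^ a) ((T ^ b) x) = (T ^ (a + b)) x := by
  rw [zpow_add, Homeomorph.mul_apply]

/-- The greedy construction: points are successively put into `F` or ruled out (put into `G`),
except those with a translate outside some `P i ∪ N i`. -/
theorem exists_greedy_marker {X : Type*} [TopologicalSpace X] (T : X ≃ₜ X) {ι : Type*}
    (P N : ι → Set X) (hP : ∀ i, IsOpen (P i)) (hN : ∀ i, IsOpen (N i))
    (hPN : ∀ i, Disjoint (P i) (N i)) (n : ℕ)
    (hPn : ∀ i, ∀ j ∈ Finset.Icc (-n : ℤ) n, j ≠ 0 → ∀ y ∈ P i, (T ^ j) y ∉ P i) (S : Finset ι) :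
    ∃ F G : Set X, IsOpen F ∧ IsOpen G ∧ Disjoint F G ∧
      (∀ j ∈ Finset.Icc (-n : ℤ) n, j ≠ 0 → ∀ y ∈ F, (T ^ j) y ∉ F) ∧
      ∀ x, (∀ a : ℤ, |a| ≤ S.card * n → ∀ i ∈ S, (T ^ a) x ∈ P i ∪ N i) →
        x ∈ F ∪ G ∧ ((∃ i ∈ S, x ∈ P i) → ∃ j ∈ Finset.Icc (-n : ℤ) n, (T ^ j) x ∈ F) := by
  classical
  induction S using Finset.induction_on with
  | empty => exact ⟨∅, Set.univ, isOpen_empty, isOpen_univ, by simp, by simp, by simp⟩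
  | insert k S hk ih =>
    obtain ⟨F, G, hF, hG, hFG, hFn, hclean⟩ := ih
    have hFG' : ∀ x, x ∈ F → x ∈ G → False := fun x h => Set.disjoint_left.mp hFG h
    have hPN' : ∀ x, x ∈ P k → x ∈ N k → False := fun x h => Set.disjoint_left.mp (hPN k) h
    -- A point of `P k` is added only if its whole window is already ruled out; a point stays ruled
    -- out if it lies in `N k` or has a translate in the old `F` within `n` steps.
    refine ⟨F ∪ (P k ∩ ⋂ j ∈ Finset.Icc (-n : ℤ) n, (T ^ j) ⁻¹' G),
      G ∩ (N k ∪ ⋃ j ∈ Finset.Icc (-n : ℤ) n, (T ^ j) ⁻¹' F), ?_, ?_, ?_, ?_, ?_⟩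
    · exact hF.union ((hP k).inter
        (isOpen_biInter_finset fun j _ => hG.preimage (T ^ j).continuous))
    · exact hG.inter ((hN k).union (isOpen_biUnion fun j _ => hF.preimage (T ^ j).continuous))
    · rw [Set.disjoint_left]
      rintro x (hx | ⟨hxP, hxG⟩) ⟨hx1, hx2⟩
      · exact hFG' x hx hx1
      · rcases hx2 with hx2 | hx2
        · exact hPN' x hxP hx2
        · obtain ⟨j, hj, hjF⟩ := Set.mem_iUnion₂.mp hx2
          exact hFG' _ hjF (Set.mem_iInter₂.mp hxG j hj)
    · rintro j hj hj0 y (hy | ⟨hyP, hyG⟩) (hjy | ⟨hjyP, hjyG⟩)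
      · exact hFn j hj hj0 y hy hjy
      · have h1 := Set.mem_iInter₂.mp hjyG (-j)
          (by rw [Finset.mem_Icc] at *; omega)
        rw [Set.mem_preimage, zpow_apply_zpow_apply, neg_add_cancel, zpow_zero] at h1
        exact hFG' y hy h1
      · exact hFG' _ hjy (Set.mem_iInter₂.mp hyG j hj)
      · exact hPn k j hj hj0 y hyP hjyP
    · intro x hx
      rw [Finset.card_insert_of_notMem hk] at hx
      push_cast at hx
      have hwin : ∀ j ∈ Finset.Icc (-n : ℤ) n, (T ^ j) x ∈ F ∪ G := by
        intro j hj
        refine (hclean _ fun a ha i hi => ?_).1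
        rw [zpow_apply_zpow_apply]
        refine hx _ ?_ i (Finset.mem_insert_of_mem hi)
        rw [add_mul, one_mul]
        exact (abs_add_le _ _).trans (add_le_add ha (abs_le.mpr (Finset.mem_Icc.mp hj)))
      have hx0 := hclean x fun a ha i hi => hx a
        (ha.trans (by rw [add_mul, one_mul]; omega)) i (Finset.mem_insert_of_mem hi)
      have hdich : (∀ j ∈ Finset.Icc (-n : ℤ) n, (T ^ j) x ∈ G) ∨
          ∃ j ∈ Finset.Icc (-n : ℤ) n, (T ^ j) x ∈ F := by
        by_contra! h
        obtain ⟨⟨j, hj, hjG⟩, h2⟩ := h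
        exact (hwin j hj).elim (h2 j hj) hjG
      have h0n : (0 : ℤ) ∈ Finset.Icc (-n : ℤ) n := by simp
      have hxk : x ∈ P k ∪ N k := by
        have := hx 0 (by rw [abs_zero]; positivity) k (Finset.mem_insert_self _ _)
        rwa [zpow_zero] at this
      constructor
      · rcases hx0.1 with h | h
        · exact Or.inl (Or.inl h)
        · rcases hxk with hxk | hxk
          · rcases hdich with hd | ⟨j, hj, hjF⟩
            · exact Or.inl (Or.inr ⟨hxk, Set.mem_iInter₂.mpr hd⟩)
            · exact Or.inr ⟨h, Or.inr (Set.mem_iUnion₂.mpr ⟨j, hj, hjF⟩)⟩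
          · exact Or.inr ⟨h, Or.inl hxk⟩
      · rintro ⟨i, hi, hxi⟩
        rcases Finset.mem_insert.mp hi with rfl | hi
        · rcases hdich with hd | ⟨j, hj, hjF⟩
          · exact ⟨0, h0n, Or.inr ⟨by simpa using hxi, Set.mem_iInter₂.mpr (by simpa using hd)⟩⟩
          · exact ⟨j, hj, Or.inl hjF⟩
        · obtain ⟨j, hj, hjF⟩ := hx0.2 ⟨i, hi, hxi⟩
          exact ⟨j, hj, Or.inl hjF⟩

theorem isMarker_of_zpow {X : Type*} [TopologicalSpace X] {T : X ≃ₜ X} {n R : ℕ} {F : Set X}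
    (hF : ∀ j ∈ Finset.Icc (-n : ℤ) n, j ≠ 0 → ∀ y ∈ F, (T ^ j) y ∉ F)
    (hR : ∀ x, ∃ a : ℤ, |a| ≤ R ∧ (T ^ a) x ∈ F) : IsMarker T n F := by
  have hpow : ∀ i : ℕ, T^[i] = ⇑(T ^ (i : ℤ)) := fun i => by
    rw [zpow_natCast]
    exact (hom_coe_pow _ rfl (fun _ _ => rfl) _ _).symm
  refine ⟨fun i hi hin => ?_, 2 * R + 1, ?_⟩
  · rw [Set.eq_empty_iff_forall_notMem]
    rintro _ ⟨hx, y, hy, rfl⟩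
    rw [hpow] at hx
    exact hF i (by rw [Finset.mem_Icc]; omega) (by omega) y hy hx
  · refine (Set.eq_univ_of_forall fun x => ?_).symm
    -- Starting `R + 1` steps back makes the required forward time `R + 1 - a` lie in `[1, 2R + 1]`.
    obtain ⟨a, ha, haF⟩ := hR ((T ^ (-(R + 1 : ℤ))) x)
    rw [abs_le] at ha
    obtain ⟨i, hi⟩ := Int.eq_ofNat_of_zero_le (show 0 ≤ R + 1 - a by omega)
    refine Set.mem_iUnion₂.mpr ⟨i, by rw [Finset.mem_Icc]; omega, _, haF, ?_⟩
    rw [hpow, zpow_apply_zpow_apply, zpow_apply_zpow_apply, ← hi]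
    have : (R + 1 - a : ℤ) + a + -(R + 1) = 0 := by ring
    rw [this, zpow_zero, Homeomorph.one_apply]

/-- If at most `d` pairs `(i, a)` with `a` in a long window are bad for `x`, then one of the
first translates of `x` by multiples of `2 * m + 1` has no bad pair with `|a| ≤ m`. -/
theorem exists_clean_translate {X : Type*} [TopologicalSpace X] (T : X ≃ₜ X) {ι : Type*}
    (C : ι → Set X) (d m : ℕ) (x : X)
    (hC : ∀ A : Finset (ι × Finset.Icc (-(d * (2 * m + 1) + m : ℕ) : ℤ) (d * (2 * m + 1) + m : ℕ)),
      (∀ p ∈ A, (T ^ p.2.1) x ∉ C p.1) → A.card ≤ d) :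
    ∃ s : ℕ, s ≤ d ∧ ∀ a : ℤ, |a| ≤ m → ∀ i, (T ^ a) ((T ^ ((s * (2 * m + 1) : ℕ) : ℤ)) x) ∈ C i := by
  classical
  by_contra! h
  have h' : ∀ s : Fin (d + 1), ∃ p : ι × Finset.Icc (-(d * (2 * m + 1) + m : ℕ) : ℤ)
      (d * (2 * m + 1) + m : ℕ), (T ^ p.2.1) x ∉ C p.1 ∧
        |p.2.1 - (s.1 * (2 * m + 1) : ℕ)| ≤ m := by
    intro s
    have hs : s.1 * (2 * m + 1) ≤ d * (2 * m + 1) :=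
      Nat.mul_le_mul_right _ (Nat.le_of_lt_succ s.2)
    obtain ⟨a, ha, i, hi⟩ := h s (Nat.le_of_lt_succ s.2)
    rw [zpow_apply_zpow_apply] at hi
    refine ⟨(i, ⟨a + (s.1 * (2 * m + 1) : ℕ), ?_⟩), hi, by simpa using ha⟩
    rw [abs_le] at ha
    rw [Finset.mem_Icc]
    generalize s.1 * (2 * m + 1) = u at *
    generalize d * (2 * m + 1) = v at *
    omega
  choose p hp1 hp2 using h'
  have hinj : Function.Injective p := by
    intro s s' hss
    have h1 := hp2 s
    have h2 := hp2 s'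
    rw [hss] at h1
    rw [abs_le] at h1 h2
    push_cast at h1 h2
    -- A shared bad time lies within `m` of both block centres, which are multiples of `2m + 1`, so
    -- the centres coincide.
    have h3 : ((s.1 : ℤ) - s'.1) * (2 * m + 1) < 1 * (2 * m + 1) := by linarith [h1.1, h2.2]
    have h4 : ((s'.1 : ℤ) - s.1) * (2 * m + 1) < 1 * (2 * m + 1) := by linarith [h2.1, h1.2]
    have h5 := lt_of_mul_lt_mul_right h3 (by positivity)
    have h6 := lt_of_mul_lt_mul_right h4 (by positivity)
    exact Fin.ext (by omega)
  have := hC (Finset.univ.map ⟨p, hinj⟩) (by simpa using hp1)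
  simp at this

end MarkerProperty

/-! ### Assembling the marker -/

open MarkerProperty in
theorem mainTheorem7 {X : Type*} [TopologicalSpace X] [CompactSpace X]
    [TopologicalSpace.MetrizableSpace X] (T : X ≃ₜ X)
    (hdim : MarkerProperty.topologicalDim X < ⊤) (hT : MarkerProperty.IsAperiodic T) :
    MarkerProperty.HasMarkerProperty T := by
  intro n
  obtain ⟨d, hd⟩ := exists_refinement_encard_le hdim
  have hloc : ∀ x : X, ∃ (V K : Set X) (f : C(X, ℝ)), K ∈ 𝓝 x ∧
      (∀ j ∈ Finset.Icc (-n : ℤ) n, j ≠ 0 → ∀ y ∈ V, (T ^ j) y ∉ V) ∧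
      (∀ y, y ∉ V → f y = 0) ∧ ∀ y ∈ K, f y = 1 := by
    intro x
    obtain ⟨V, hVo, hxV, hV⟩ := hT.exists_isOpen_zpow_apply_notMem (Finset.Icc (-n : ℤ) n) x
    obtain ⟨K, hKx, hK, hKV⟩ := exists_mem_nhds_isClosed_subset (hVo.mem_nhds hxV)
    obtain ⟨f, hf0, hf1, -⟩ := exists_continuous_zero_one_of_isClosed hVo.isClosed_compl hK
      (Set.disjoint_left.mpr fun y hy hyK => hy (hKV hyK))
    exact ⟨V, K, f, hKx, hV, fun y hy => hf0 hy, fun y hy => hf1 hy⟩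
  choose V K f hKx hV hf0 hf1 using hloc
  obtain ⟨s, -, hs⟩ := isCompact_univ.elim_nhds_subcover K fun x _ => hKx x
  let f₀ : C(X, s → ℝ) := ⟨fun y i => f i y, continuous_pi fun i => (f i).continuous⟩
  -- Each of the `s.card` greedy steps looks `n` further along the orbit.
  let m : ℕ := s.card * n
  obtain ⟨g, hgf, hg⟩ := Metric.dense_iff.mp (dense_genericOn_univ hd hT s
    (Finset.Icc (-(d * (2 * m + 1) + m : ℕ) : ℤ) (d * (2 * m + 1) + m : ℕ)) (1 / 2)) f₀ (1 / 4)
    (by norm_num)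
  have hclose : ∀ y i, |g y i - f i y| < 1 / 4 := fun y i => by
    rw [← Real.dist_eq]
    exact (dist_le_pi_dist (g y) (f₀ y) i).trans_lt
      ((ContinuousMap.dist_apply_le_dist y).trans_lt hgf)
  have hgc : ∀ i, Continuous fun y => g y i := fun i => (continuous_apply i).comp g.continuous
  let P : s → Set X := fun i => {y | 1 / 2 < g y i}
  let N : s → Set X := fun i => {y | g y i < 1 / 2}
  have hPV : ∀ i, P i ⊆ V i := fun i y hy => by
    by_contra hyV
    have h1 := hclose y i
    rw [hf0 _ y hyV, abs_lt] at h1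
    have h2 : 1 / 2 < g y i := hy
    linarith [h1.2]
  obtain ⟨F, G, hF, -, -, hFn, hclean⟩ := exists_greedy_marker T P N
    (fun i => isOpen_lt continuous_const (hgc i)) (fun i => isOpen_lt (hgc i) continuous_const)
    (fun i => Set.disjoint_left.mpr fun y (h1 : 1 / 2 < g y i) (h2 : g y i < 1 / 2) =>
      lt_asymm h1 h2)
    n (fun i j hj hj0 y hy hjy => hV i j hj hj0 y (hPV i hy) (hPV i hjy)) Finset.univ
  refine ⟨F, hF, isMarker_of_zpow (R := d * (2 * m + 1) + n) hFn fun x => ?_⟩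
  obtain ⟨l, hl, hlx⟩ := exists_clean_translate T (fun i => P i ∪ N i) d m x fun A hA =>
    hg x trivial A fun p hp => by
      have h := hA p hp
      simp only [Set.mem_union, P, N, Set.mem_ofPred_eq, not_or, not_lt] at h
      exact le_antisymm h.1 h.2
  obtain ⟨i, hi, hxi⟩ := Set.mem_iUnion₂.mp
    (hs (Set.mem_univ ((T ^ ((l * (2 * m + 1) : ℕ) : ℤ)) x)))
  obtain ⟨j, hj, hjF⟩ := (hclean _ fun a ha i _ => hlx a (by simpa [m] using ha) i).2
    ⟨⟨i, hi⟩, Finset.mem_univ _, by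
      have h1 := hclose ((T ^ ((l * (2 * m + 1) : ℕ) : ℤ)) x) ⟨i, hi⟩
      rw [hf1 _ _ hxi, abs_lt] at h1
      show (1 / 2 : ℝ) < g _ ⟨i, hi⟩
      linarith [h1.1]⟩
  rw [zpow_apply_zpow_apply] at hjF
  refine ⟨_, ?_, hjF⟩
  have hl' : l * (2 * m + 1) ≤ d * (2 * m + 1) := Nat.mul_le_mul_right _ hl
  rw [Finset.mem_Icc] at hj
  rw [abs_le]
  generalize l * (2 * m + 1) = u at *
  generalize d * (2 * m + 1) = v at *
  omega
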